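/- Theorem 1. Let there be $K$ arms (beam pairs), numbered $1,\dots,K$. Selecting arm $k$ in a time slot gives a Bernoulli success with unknown probability $\theta_k\in[0,1]$, independently of the past given the selected arm, and a success is worth the known received energy $p_k>0$; the mean reward of arm $k$ is $p_k\theta_k$. Let $\mathcal U$ be the set of those $\theta\in[0,1]^K$ whose mean rewards are strictly unimodal: for some arm $k^*=k^*(\theta)$, $$p_1\theta_1<\dots<p_{k^*}\theta_{k^*}\quad\text{and}\quad p_{k^*}\theta_{k^*}>p_{k^*+1}\theta_{k^*+1}>\dots>p_K\theta_K .$$ A beam-alignment (arm-selection) policy $\pi$ chooses in each slot one arm, possibly at random, on the basis of the arms chosen and the outcomes observed so far. With $s_k^\pi(T)$ the number of times that $\pi$ selects arm $k$ in the first $T$ slots, its regret is $$\mathcal R^\pi(T)=p_{k^*}\theta_{k^*}T-\sum_k \mathbb E_\theta[s_k^\pi(T)]\,p_k\theta_k .$$ The policy $\pi$ is called uniformly good if for every $\theta\in\mathcal U$ and every $a>0$ its regret under $\theta$ satisfies $\mathcal R^\pi(T)=o(T^a)$ as $T\to\infty$. Then for every uniformly good policy $\pi$ and every $\theta\in\mathcal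 U$, $$\liminf_{T\to\infty}\frac{\mathcal R^\pi(T)}{\log T}\ \ge\ c(\theta):=\sum_{k\in N(k^*)}\frac{p_{k^*}\theta_{k^*}-p_k\theta_k}{I\!\left(\theta_k,\ p_{k^*}\theta_{k^*}/p_k\right)},$$ where $N(k^*)=\{j\in\{k^*-1,k^*+1\}\cap\{1,\dots,K\}: p_{k^*}\theta_{k^*}\le p_j\}$ is the set of neighbours of the optimal arm, and $I(a,b)=a\log\frac ab+(1-a)\log\frac{1-a}{1-b}$ is the Kullback-Leibler divergence of the Bernoulli distributions with parameters $a$ and $b$ (with values in $[0,\infty]$, $0\log 0=0$, and a term with $I=\infty$ counted as $0$). In particular $c(\theta)$ has at most two terms, whatever the number $K$ of beam pairs. -/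

import Mathlib

open Filter Asymptotics
open scoped ENNReal Topology

noncomputable section

namespace BeamBandit

/-- What has been seen after `n` slots: for each slot, the arm (beam pair) that was selected
and whether the matching was successful. -/
abbrev History (K n : ℕ) : Type := Fin n → Fin K × Bool

/-- A beam-alignment (arm-selection) policy: in slot `n`, given the arms selected and the
outcomes observed in the slots before `n`, it draws the next arm from a probability distribution
on the arms. Point masses are allowed, so deterministic policies are included. The received
energies `p` are known, hence a policy may depend on them. -/
abbrev Policy (K : ℕ) : Type := (n : ℕ) → History K n → PMF (Fin K)

/-- The part of a history that precedes slot `t`. -/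
def History.before {K T : ℕ} (h : History K T) (t : Fin T) : History K (t : ℕ) :=
  fun i => h (Fin.castLE t.isLt.le i)

/-- Probability of the outcome `x` of a Bernoulli trial with success probability `q`. -/
def outcomeProb (q : ℝ) (x : Bool) : ℝ := if x then q else 1 - q

/-- Probability of the history `h` under the policy `π` when the success probabilities of the
arms are `θ` : in each slot the arm is drawn by the policy from the past, and then the outcome is
Bernoulli with the parameter of the selected arm, independently of the past. -/
def historyProb {K : ℕ} (π : Policy K) (θ : Fin K → ℝ) {T : ℕ} (h : History K T) : ℝ :=
  ∏ t : Fin T, (π t (h.before t) (h t).1).toReal * outcomeProb (θ (h t).1) (h t).2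

/-- The number of times that arm `k` is selected in the history `h`. -/
def pulls {K T : ℕ} (h : History K T) (k : Fin K) : ℕ :=
  (Finset.univ.filter fun t : Fin T => (h t).1 = k).card

/-- The expected number of times that arm `k` is selected within `T` slots. -/
def expectedPulls {K : ℕ} (π : Policy K) (θ : Fin K → ℝ) (T : ℕ) (k : Fin K) : ℝ :=
  ∑ h : History K T, historyProb π θ h * (pulls h k : ℝ)

/-- The regret of `π` over `T` slots; `kstar` is the optimal arm, and an arm `k` yields the
reward `p k` with probability `θ k` and `0` otherwise. -/
def regret {K : ℕ} (π : Policy K) (p θ : Fin K → ℝ) (kstar : Fin K) (T : ℕ) : ℝ :=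
  p kstar * θ kstar * (T : ℝ) - ∑ k : Fin K, expectedPulls π θ T k * (p k * θ k)

/-- `θ` is a vector of success probabilities for which the mean rewards `p k * θ k` are strictly
unimodal with peak `kstar`. -/
structure UnimodalAt {K : ℕ} (p θ : Fin K → ℝ) (kstar : Fin K) : Prop where
  mem_Icc : ∀ k, θ k ∈ Set.Icc (0 : ℝ) 1
  strictMonoOn : StrictMonoOn (fun k => p k * θ k) (Set.Iic kstar)
  strictAntiOn : StrictAntiOn (fun k => p k * θ k) (Set.Ici kstar)

/-- Uniformly good policies: on every instance of the unimodal class the regret is `o(T ^ a)`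
for every `a > 0`. -/
def UniformlyGood {K : ℕ} (p : Fin K → ℝ) (π : Policy K) : Prop :=
  ∀ (θ : Fin K → ℝ) (kstar : Fin K), UnimodalAt p θ kstar → ∀ a : ℝ, 0 < a →
    (fun T : ℕ => regret π p θ kstar T) =o[atTop] fun T : ℕ => (T : ℝ) ^ a

/-- The neighbours of arm `k` : the arms `j` next to `k` with `p k * θ k ≤ p j`. -/
def neighbours {K : ℕ} (p θ : Fin K → ℝ) (k : Fin K) : Finset (Fin K) :=
  Finset.univ.filter fun j =>
    ((j : ℕ) + 1 = (k : ℕ) ∨ (j : ℕ) = (k : ℕ) + 1) ∧ p k * θ k ≤ p j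

/-- The Kullback-Leibler divergence `I(a, b)` of the Bernoulli distributions with parameters
`a` and `b`, with the usual conventions `0 log 0 = 0` and `x log (x / 0) = ∞` for `x > 0`. -/
def bernoulliKL (a b : ℝ) : ℝ≥0∞ :=
  if (b = 0 ∧ a ≠ 0) ∨ (b = 1 ∧ a ≠ 1) then ⊤
  else ENNReal.ofReal
    (a * Real.log (a / b) + (1 - a) * Real.log ((1 - a) / (1 - b)))

/-- The constant `c(θ)` of the lower bound: a sum over the neighbours of the optimal arm. -/
def lowerConst {K : ℕ} (p θ : Fin K → ℝ) (kstar : Fin K) : ℝ≥0∞ :=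
  ∑ k ∈ neighbours p θ kstar,
    ENNReal.ofReal (p kstar * θ kstar - p k * θ k) /
      bernoulliKL (θ k) (p kstar * θ kstar / p k)

end BeamBandit

end

namespace BeamBandit

variable {K : ℕ}

/-! Change of measure in the manner of Lai and Robbins. For an arm `k` next to the peak, raise `θ k`
alone to some `b < 1` with `p k * b` just above the optimal mean. Adjacency keeps the instance
unimodal, now with peak `k` (`UnimodalAt.update`), so a uniformly good policy must leave `k` at most
`T ^ a` times there, although under `θ` it pulls `k` only `o(T)` times.

The two laws differ only in slots using `k`, so their expected log-likelihood ratio is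
`expectedPulls π θ T k * realKL (θ k) b`. An exponential-moment bound
(`le_expectedPulls_mul_realKL`) shows that this is at least about `(1 - a) * log T`. Letting `b`
decrease to `p kstar * θ kstar / p k` and `a` to `0` gives the cost of one neighbour; the costs add
up because regret is a sum of nonnegative terms over the arms. -/

/-! ### Expectations over finite histories -/

theorem historyProb_snoc (π : Policy K) (θ : Fin K → ℝ) {T : ℕ} (h : History K T)
    (y : Fin K × Bool) :
    historyProb π θ (Fin.snoc h y : History K (T + 1)) =
      historyProb π θ h * ((π T h y.1).toReal * outcomeProb (θ y.1) y.2) := by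
  unfold historyProb
  rw [Fin.prod_univ_castSucc]
  have hb : History.before (Fin.snoc h y : History K (T + 1)) (Fin.last T) = h := by
    funext i
    exact Fin.snoc_castSucc (α := fun _ => Fin K × Bool) y h i
  have hc : ∀ t : Fin T,
      History.before (Fin.snoc h y : History K (T + 1)) t.castSucc = h.before t := by
    intro t
    funext i
    exact Fin.snoc_castSucc (α := fun _ => Fin K × Bool) y h (Fin.castLE t.isLt.le i)
  congr 1
  · refine Finset.prod_congr rfl fun t _ => ?_
    rw [hc, Fin.snoc_castSucc (α := fun _ => Fin K × Bool)]
    rfl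
  · rw [hb, Fin.snoc_last]
    rfl

theorem sum_history_succ {T : ℕ} (G : History K (T + 1) → ℝ) :
    ∑ h, G h = ∑ h : History K T, ∑ y : Fin K × Bool, G (Fin.snoc h y) := by
  rw [← (Fin.snocEquiv fun _ : Fin (T + 1) => Fin K × Bool).sum_comp, Fintype.sum_prod_type,
    Finset.sum_comm]
  rfl

theorem sum_toReal_pmf {α : Type*} [Fintype α] (q : PMF α) : ∑ a, (q a).toReal = 1 := by
  rw [← ENNReal.toReal_sum fun a _ => q.apply_ne_top a, ← tsum_fintype (L := .unconditional _), q.tsum_coe]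
  rfl

theorem sum_outcomeProb (q : ℝ) : ∑ x, outcomeProb q x = 1 := by
  simp [outcomeProb]

/-- Tower property: condition on the first `T` slots. It drives the inductions on the horizon. -/
theorem sum_historyProb_succ (π : Policy K) (θ : Fin K → ℝ) {T : ℕ}
    (G : History K (T + 1) → ℝ) :
    ∑ h, historyProb π θ h * G h = ∑ h : History K T, historyProb π θ h *
      ∑ a, (π T h a).toReal * ∑ x, outcomeProb (θ a) x * G (Fin.snoc h (a, x)) := by
  rw [sum_history_succ]
  refine Finset.sum_congr rfl fun h _ => ?_
  rw [Fintype.sum_prod_type, Finset.mul_sum]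
  refine Finset.sum_congr rfl fun a _ => ?_
  rw [Finset.mul_sum, Finset.mul_sum]
  refine Finset.sum_congr rfl fun x _ => ?_
  rw [historyProb_snoc]
  ring

theorem sum_historyProb (π : Policy K) (θ : Fin K → ℝ) (T : ℕ) :
    ∑ h : History K T, historyProb π θ h = 1 := by
  induction T with
  | zero => simp [historyProb]
  | succ T ih =>
    have := sum_historyProb_succ π θ (T := T) fun _ => 1
    simp only [mul_one, sum_outcomeProb, sum_toReal_pmf] at this
    rw [this, ih]

theorem outcomeProb_nonneg {q : ℝ} (hq : q ∈ Set.Icc (0 : ℝ) 1) (x : Bool) :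
    0 ≤ outcomeProb q x := by
  cases x <;> simp [outcomeProb, hq.1, hq.2]

theorem historyProb_nonneg (π : Policy K) {θ : Fin K → ℝ} (hθ : ∀ k, θ k ∈ Set.Icc (0 : ℝ) 1)
    {T : ℕ} (h : History K T) : 0 ≤ historyProb π θ h :=
  Finset.prod_nonneg fun _ _ =>
    mul_nonneg ENNReal.toReal_nonneg (outcomeProb_nonneg (hθ _) _)

/-- A sum over the slots of terms with conditional mean zero has mean zero. -/
theorem expect_sum_eq_zero (π : Policy K) (θ : Fin K → ℝ) (g : Fin K × Bool → ℝ)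
    (hg : ∀ a, ∑ x, outcomeProb (θ a) x * g (a, x) = 0) (T : ℕ) :
    ∑ h : History K T, historyProb π θ h * ∑ t, g (h t) = 0 := by
  induction T with
  | zero => simp
  | succ T ih =>
    rw [sum_historyProb_succ, ← ih]
    refine Finset.sum_congr rfl fun h _ => ?_
    congr 1
    have : ∀ a, ∑ x, outcomeProb (θ a) x *
        ∑ t, g ((Fin.snoc h (a, x) : History K (T + 1)) t) = ∑ t, g (h t) := by
      intro a
      have hs : ∀ x, ∑ t, g ((Fin.snoc h (a, x) : History K (T + 1)) t) =
          ∑ t, g (h t) + g (a, x) := by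
        intro x
        rw [Fin.sum_univ_castSucc, Fin.snoc_last]
        congr 1
        exact Finset.sum_congr rfl fun t _ => by
          rw [Fin.snoc_castSucc (α := fun _ => Fin K × Bool)]
      simp_rw [hs, mul_add]
      rw [Finset.sum_add_distrib, hg, ← Finset.sum_mul, sum_outcomeProb]
      ring
    simp_rw [this]
    rw [← Finset.sum_mul, sum_toReal_pmf, one_mul]

theorem pulls_eq_sum {T : ℕ} (h : History K T) (k : Fin K) :
    (pulls h k : ℝ) = ∑ t, if (h t).1 = k then (1 : ℝ) else 0 := by
  rw [pulls, Finset.sum_boole]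

theorem sum_pulls {T : ℕ} (h : History K T) : ∑ k, (pulls h k : ℝ) = T := by
  simp_rw [pulls_eq_sum]
  rw [Finset.sum_comm]
  simp

theorem pulls_le {T : ℕ} (h : History K T) (k : Fin K) : pulls h k ≤ T := by
  simpa [pulls] using Finset.card_filter_le (Finset.univ : Finset (Fin T)) fun t => (h t).1 = k

theorem expectedPulls_nonneg (π : Policy K) {θ : Fin K → ℝ}
    (hθ : ∀ k, θ k ∈ Set.Icc (0 : ℝ) 1) (T : ℕ) (k : Fin K) : 0 ≤ expectedPulls π θ T k :=
  Finset.sum_nonneg fun h _ => mul_nonneg (historyProb_nonneg π hθ h) (Nat.cast_nonneg _)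

theorem sum_expectedPulls (π : Policy K) (θ : Fin K → ℝ) (T : ℕ) :
    ∑ k, expectedPulls π θ T k = T := by
  unfold expectedPulls
  rw [Finset.sum_comm]
  simp_rw [← Finset.mul_sum, sum_pulls, ← Finset.sum_mul, sum_historyProb, one_mul]

theorem regret_eq_sum (π : Policy K) (p θ : Fin K → ℝ) (kstar : Fin K) (T : ℕ) :
    regret π p θ kstar T =
      ∑ k, expectedPulls π θ T k * (p kstar * θ kstar - p k * θ k) := by
  simp_rw [regret, mul_sub, Finset.sum_sub_distrib, ← Finset.sum_mul, sum_expectedPulls]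
  ring

/-! ### Change of measure -/

/-- The Kullback-Leibler divergence of Bernoulli distributions as a real number. -/
noncomputable def realKL (a b : ℝ) : ℝ :=
  a * Real.log (a / b) + (1 - a) * Real.log ((1 - a) / (1 - b))

/-- The log-likelihood ratio contributed by one slot when only the parameter of arm `k`
changes, from `a` to `b`. -/
noncomputable def slotLogRatio (k : Fin K) (a b : ℝ) (y : Fin K × Bool) : ℝ :=
  if y.1 = k then Real.log (outcomeProb a y.2 / outcomeProb b y.2) else 0

theorem expect_sum_slotLogRatio (π : Policy K) (θ : Fin K → ℝ) (k : Fin K) (b : ℝ) (T : ℕ) :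
    ∑ h : History K T, historyProb π θ h * ∑ t, slotLogRatio k (θ k) b (h t) =
      expectedPulls π θ T k * realKL (θ k) b := by
  -- Centre each slot's log-ratio by its conditional mean given the arm (Wald's identity).
  have key := expect_sum_eq_zero π θ
    (fun y => slotLogRatio k (θ k) b y - (if y.1 = k then 1 else 0) * realKL (θ k) b)
    (by
      intro a
      by_cases ha : a = k
      · subst ha
        simp [slotLogRatio, outcomeProb, realKL]
        ring
      · simp [slotLogRatio, ha]) T
  simp_rw [Finset.sum_sub_distrib, mul_sub, Finset.sum_sub_distrib, ← Finset.sum_mul,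
    ← pulls_eq_sum, ← mul_assoc, ← Finset.sum_mul] at key
  exact sub_eq_zero.mp key

/-- Slot by slot this is an equality, except at outcomes of probability zero under `θ k`: there
`Real.log 0 = 0` spoils the ratio, but the left factor vanishes. -/
theorem historyProb_mul_exp_le (π : Policy K) {θ : Fin K → ℝ}
    (hθ : ∀ k, θ k ∈ Set.Icc (0 : ℝ) 1) (k : Fin K) {b : ℝ} (hb : b ∈ Set.Ioo (0 : ℝ) 1)
    {T : ℕ} (h : History K T) :
    historyProb π θ h * Real.exp (-∑ t, slotLogRatio k (θ k) b (h t)) ≤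
      historyProb π (Function.update θ k b) h := by
  rw [← Finset.sum_neg_distrib, Real.exp_sum, historyProb, historyProb, ← Finset.prod_mul_distrib]
  refine Finset.prod_le_prod (fun t _ => ?_) fun t _ => ?_
  · exact mul_nonneg (mul_nonneg ENNReal.toReal_nonneg (outcomeProb_nonneg (hθ _) _))
      (Real.exp_pos _).le
  · rw [mul_assoc]
    refine mul_le_mul_of_nonneg_left ?_ ENNReal.toReal_nonneg
    obtain ⟨j, x⟩ := h t
    by_cases hj : j = k
    · subst hj
      have hbx : 0 < outcomeProb b x := by
        cases x <;> simp [outcomeProb, hb.1, hb.2]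
      simp only [slotLogRatio, if_true, Function.update_self]
      rcases (outcomeProb_nonneg (hθ j) x).eq_or_lt with h0 | h0
      · rw [← h0, zero_mul]
        exact hbx.le
      · rw [Real.exp_neg, Real.exp_log (div_pos h0 hbx)]
        exact le_of_eq (by field_simp)
    · simp [slotLogRatio, hj]

/-- Convexity: the chord over `[0, 1]` lies above the graph. It reduces an exponential moment to an
expected number of pulls. -/
theorem exp_mul_le {c u : ℝ} (h0 : 0 ≤ u) (h1 : u ≤ 1) :
    Real.exp (c * u) ≤ 1 + u * (Real.exp c - 1) := by
  have := convexOn_exp.2 (Set.mem_univ c) (Set.mem_univ 0) h0 (sub_nonneg.mpr h1) (by ring)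
  simp only [smul_eq_mul, mul_zero, add_zero, Real.exp_zero, mul_one] at this
  rw [mul_comm c u]
  linarith

/-- The change of measure inequality: if arm `k` would be pulled nearly always under the
parameter `b`, then it has to be explored under `θ`. -/
theorem le_expectedPulls_mul_realKL (π : Policy K) {θ : Fin K → ℝ}
    (hθ : ∀ k, θ k ∈ Set.Icc (0 : ℝ) 1) (k : Fin K) {b : ℝ} (hb : b ∈ Set.Ioo (0 : ℝ) 1)
    {T : ℕ} (hT : 0 < T) {c : ℝ}
    (hc : (T - expectedPulls π (Function.update θ k b) T k) * (Real.exp c - 1) ≤ T) :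
    c * (1 - expectedPulls π θ T k / T) - Real.log 2 ≤
      expectedPulls π θ T k * realKL (θ k) b := by
  have hT' : (0 : ℝ) < T := by exact_mod_cast hT
  have hb' : ∀ j, Function.update θ k b j ∈ Set.Icc (0 : ℝ) 1 := by
    intro j
    by_cases hj : j = k
    · subst hj; simpa using Set.Ioo_subset_Icc_self hb
    · simpa [hj] using hθ j
  set L : History K T → ℝ := fun h => ∑ t, slotLogRatio k (θ k) b (h t) with hL
  -- Test function for the variational bound: near `c` when `k` is rarely pulled, near `0` when it
  -- is nearly always pulled.
  set f : History K T → ℝ := fun h => c * (1 - pulls h k / T) with hf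
  have hQ : ∑ h, historyProb π (Function.update θ k b) h * Real.exp (f h) ≤ 2 := by
    calc ∑ h, historyProb π (Function.update θ k b) h * Real.exp (f h)
        ≤ ∑ h : History K T, historyProb π (Function.update θ k b) h *
          (1 + (1 - pulls h k / T) * (Real.exp c - 1)) := by
          refine Finset.sum_le_sum fun h _ =>
            mul_le_mul_of_nonneg_left (exp_mul_le ?_ ?_) (historyProb_nonneg π hb' h)
          · rw [sub_nonneg, div_le_one hT']
            exact_mod_cast pulls_le h k
          · have : (0 : ℝ) ≤ pulls h k / T := by positivity
            linarith
      _ = 1 + (T - expectedPulls π (Function.update θ k b) T k) * (Real.exp c - 1) / T := by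
          have : ∀ h : History K T, historyProb π (Function.update θ k b) h *
              (1 + (1 - pulls h k / T) * (Real.exp c - 1)) =
              historyProb π (Function.update θ k b) h * Real.exp c -
              historyProb π (Function.update θ k b) h * pulls h k * ((Real.exp c - 1) / T) := by
            intro h; ring
          simp_rw [this]
          rw [Finset.sum_sub_distrib, ← Finset.sum_mul, ← Finset.sum_mul, sum_historyProb,
            expectedPulls]
          field_simp
          ring
      _ ≤ 2 := by
          have := (div_le_one hT').mpr hc
          linarith
  -- Pointwise `exp (-x) ≥ 1 - x` at `x = L - f + log 2`. The `log 2` matches the bound `2` in `hQ`,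
  -- so the left side is at least `1 - 2 / 2 = 0`.
  have hmain : ∑ h, (historyProb π θ h -
      historyProb π (Function.update θ k b) h * Real.exp (f h) / 2) ≤
      ∑ h, historyProb π θ h * (L h - f h + Real.log 2) := by
    refine Finset.sum_le_sum fun h _ => ?_
    have h1 := Real.add_one_le_exp (-(L h - f h + Real.log 2))
    have h2 : Real.exp (-(L h - f h + Real.log 2)) = Real.exp (-L h) * Real.exp (f h) / 2 := by
      rw [show -(L h - f h + Real.log 2) = -L h + f h - Real.log 2 by ring, Real.exp_sub,
        Real.exp_add, Real.exp_log two_pos]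
    have h3 := mul_le_mul_of_nonneg_right (historyProb_mul_exp_le π hθ k hb h)
      (Real.exp_pos (f h)).le
    have h4 := mul_le_mul_of_nonneg_left h1 (historyProb_nonneg π hθ h)
    rw [h2] at h4
    linarith
  have hE : ∑ h, historyProb π θ h * (L h - f h + Real.log 2) =
      expectedPulls π θ T k * realKL (θ k) b - c * (1 - expectedPulls π θ T k / T)
        + Real.log 2 := by
    have : ∀ h : History K T, historyProb π θ h * (L h - f h + Real.log 2) =
        historyProb π θ h * L h + historyProb π θ h * (Real.log 2 - c) +
        historyProb π θ h * pulls h k * (c / T) := by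
      intro h; simp only [hf]; ring
    simp_rw [this]
    rw [Finset.sum_add_distrib, Finset.sum_add_distrib, ← Finset.sum_mul, ← Finset.sum_mul,
      sum_historyProb, expect_sum_slotLogRatio]
    simp only [expectedPulls]
    ring
  rw [hE, Finset.sum_sub_distrib, sum_historyProb, ← Finset.sum_div] at hmain
  linarith

/-! ### Unimodal instances -/

theorem UnimodalAt.lt_peak {p θ : Fin K → ℝ} {kstar : Fin K} (h : UnimodalAt p θ kstar)
    {j : Fin K} (hj : j ≠ kstar) : p j * θ j < p kstar * θ kstar := by
  rcases lt_or_gt_of_ne hj with hlt | hgt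
  · exact h.strictMonoOn (Set.mem_Iic.mpr hlt.le) Set.self_mem_Iic hlt
  · exact h.strictAntiOn Set.self_mem_Ici (Set.mem_Ici.mpr hgt.le) hgt

theorem UnimodalAt.le_peak {p θ : Fin K → ℝ} {kstar : Fin K} (h : UnimodalAt p θ kstar)
    (j : Fin K) : p j * θ j ≤ p kstar * θ kstar := by
  rcases eq_or_ne j kstar with rfl | hj
  · exact le_rfl
  · exact (h.lt_peak hj).le

/-- Raising the mean reward of an arm next to the peak above the peak moves the peak there. -/
theorem UnimodalAt.update {p θ : Fin K → ℝ} {kstar k : Fin K} (h : UnimodalAt p θ kstar)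
    (hk : (k : ℕ) + 1 = (kstar : ℕ) ∨ (k : ℕ) = (kstar : ℕ) + 1) {b : ℝ}
    (hb : b ∈ Set.Icc (0 : ℝ) 1) (hgt : p kstar * θ kstar < p k * b) :
    UnimodalAt p (Function.update θ k b) k := by
  refine ⟨fun j => ?_, fun i hi j hj hij => ?_, fun i hi j hj hij => ?_⟩
  · by_cases hj : j = k
    · subst hj; simpa using hb
    · simpa [hj] using h.mem_Icc j
  · simp only [Set.mem_Iic] at hi hj
    have hik : i ≠ k := (hij.trans_le hj).ne
    rcases hj.eq_or_lt with rfl | hjk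
    · simpa [hik] using (h.le_peak i).trans_lt hgt
    · have hjs : j ≤ kstar := by
        rw [Fin.le_def]; rw [Fin.lt_def] at hjk; omega
      simpa [hik, hjk.ne] using
        h.strictMonoOn (Set.mem_Iic.mpr (hij.le.trans hjs)) (Set.mem_Iic.mpr hjs) hij
  · simp only [Set.mem_Ici] at hi hj
    have hjk : j ≠ k := (hi.trans_lt hij).ne'
    rcases hi.eq_or_lt with rfl | hki
    · simpa [hjk] using (h.le_peak j).trans_lt hgt
    · have his : kstar ≤ i := by
        rw [Fin.le_def]; rw [Fin.lt_def] at hki; omega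
      simpa [hjk, hki.ne'] using
        h.strictAntiOn (Set.mem_Ici.mpr his) (Set.mem_Ici.mpr (his.trans hij.le)) hij

/-! ### Consequences of uniform goodness -/

theorem sub_expectedPulls_eq (π : Policy K) (θ : Fin K → ℝ) (kstar : Fin K) (T : ℕ) :
    T - expectedPulls π θ T kstar = ∑ j ∈ Finset.univ.erase kstar, expectedPulls π θ T j := by
  rw [← sum_expectedPulls π θ T, ← Finset.sum_erase_add _ _ (Finset.mem_univ kstar)]
  ring

theorem UniformlyGood.eventually_sub_expectedPulls_le {p θ : Fin K → ℝ} {kstar : Fin K}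
    {π : Policy K} (hπ : UniformlyGood p π) (h : UnimodalAt p θ kstar) {a : ℝ} (ha : 0 < a) :
    ∀ᶠ T : ℕ in atTop, T - expectedPulls π θ T kstar ≤ (T : ℝ) ^ a := by
  -- A common lower bound for the gaps; taking it near `0` also covers the case of no suboptimal
  -- arm. Used as the little-o constant, it cancels.
  obtain ⟨Δ, hΔ, hΔ0⟩ : ∃ Δ : ℝ,
      (∀ j, j ≠ kstar → Δ ≤ p kstar * θ kstar - p j * θ j) ∧ 0 < Δ := by
    have h1 : ∀ᶠ Δ : ℝ in 𝓝[>] 0, ∀ j, j ≠ kstar → Δ ≤ p kstar * θ kstar - p j * θ j := by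
      rw [eventually_all]
      intro j
      by_cases hj : j = kstar
      · simp [hj]
      · filter_upwards [nhdsWithin_le_nhds (Iio_mem_nhds (sub_pos.mpr (h.lt_peak hj)))]
          with Δ hΔ _ using le_of_lt hΔ
    exact (h1.and self_mem_nhdsWithin).exists
  filter_upwards [(hπ θ kstar h a ha).bound hΔ0] with T hT
  have h2 : Δ * (T - expectedPulls π θ T kstar) ≤ regret π p θ kstar T := by
    rw [sub_expectedPulls_eq, regret_eq_sum, Finset.mul_sum,
      ← Finset.sum_erase_add _ _ (Finset.mem_univ kstar), sub_self, mul_zero, add_zero]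
    refine Finset.sum_le_sum fun j hj => ?_
    rw [mul_comm]
    exact mul_le_mul_of_nonneg_left (hΔ j (Finset.ne_of_mem_erase hj))
      (expectedPulls_nonneg π h.mem_Icc T j)
  rw [Real.norm_of_nonneg (Real.rpow_nonneg T.cast_nonneg a)] at hT
  exact le_of_mul_le_mul_left (h2.trans ((Real.le_norm_self _).trans hT)) hΔ0

theorem UniformlyGood.tendsto_expectedPulls_div {p θ : Fin K → ℝ} {kstar j : Fin K}
    {π : Policy K} (hπ : UniformlyGood p π) (h : UnimodalAt p θ kstar) (hj : j ≠ kstar) :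
    Tendsto (fun T : ℕ => expectedPulls π θ T j / T) atTop (𝓝 0) := by
  have hlim : Tendsto (fun T : ℕ => (T : ℝ) ^ (-(1 / 2) : ℝ)) atTop (𝓝 0) :=
    (tendsto_rpow_neg_atTop (by norm_num)).comp tendsto_natCast_atTop_atTop
  refine tendsto_of_tendsto_of_tendsto_of_le_of_le' tendsto_const_nhds hlim
    (Eventually.of_forall fun T =>
      div_nonneg (expectedPulls_nonneg π h.mem_Icc T j) T.cast_nonneg) ?_
  filter_upwards [hπ.eventually_sub_expectedPulls_le h (show (0 : ℝ) < 1 / 2 by norm_num),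
    eventually_gt_atTop 0] with T hT hT0
  have hT0' : (0 : ℝ) < T := by exact_mod_cast hT0
  rw [sub_expectedPulls_eq] at hT
  have hle := (Finset.single_le_sum (fun i _ => expectedPulls_nonneg π h.mem_Icc T i)
    (Finset.mem_erase.mpr ⟨hj, Finset.mem_univ j⟩)).trans hT
  rw [div_le_iff₀ hT0']
  calc expectedPulls π θ T j ≤ (T : ℝ) ^ (1 / 2 : ℝ) := hle
    _ = (T : ℝ) ^ (-(1 / 2) : ℝ) * T := by
      rw [← Real.rpow_add_one hT0'.ne']; norm_num

/-! ### Positivity and continuity of the divergence -/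

theorem realKL_pos {a b : ℝ} (ha : 0 ≤ a) (hab : a < b) (hb : b < 1) : 0 < realKL a b := by
  have hb0 : 0 < b := ha.trans_lt hab
  have h1 : a - b ≤ a * Real.log (a / b) := by
    rcases ha.eq_or_lt with rfl | ha
    · simpa using hb0.le
    · have := mul_le_mul_of_nonneg_left
        (Real.one_sub_inv_le_log_of_pos (div_pos ha hb0)) ha.le
      rw [inv_div, mul_sub, mul_one, mul_div_cancel₀ _ ha.ne'] at this
      exact this
  have h2 : b - a < (1 - a) * Real.log ((1 - a) / (1 - b)) := by
    have ha1 : 0 < 1 - a := by linarith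
    have hb1 : 0 < 1 - b := by linarith
    have hne : (1 - b) / (1 - a) ≠ 1 := by
      rw [Ne, div_eq_one_iff_eq ha1.ne']; intro h; linarith
    have := mul_lt_mul_of_pos_left (Real.log_lt_sub_one_of_pos (div_pos hb1 ha1) hne) ha1
    have hinv : Real.log ((1 - b) / (1 - a)) = -Real.log ((1 - a) / (1 - b)) := by
      rw [← Real.log_inv, inv_div]
    rw [hinv, mul_sub, mul_div_cancel₀ _ ha1.ne', mul_neg] at this
    linarith
  unfold realKL
  linarith

theorem continuousAt_realKL {a b : ℝ} (ha : a < 1) (hb0 : 0 < b) (hb : b < 1) :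
    ContinuousAt (realKL a) b := by
  have h2 : ContinuousAt (fun x => (1 - a) * Real.log ((1 - a) / (1 - x))) b := by
    have hb1 : 1 - b ≠ 0 := by linarith
    refine continuousAt_const.mul (ContinuousAt.log (continuousAt_const.div (by fun_prop) hb1) ?_)
    exact div_ne_zero (by linarith) hb1
  refine ContinuousAt.add ?_ h2
  -- At `a = 0` the logarithm is evaluated at its discontinuity, but its coefficient vanishes.
  rcases eq_or_ne a 0 with rfl | ha0
  · simpa using continuousAt_const
  · exact continuousAt_const.mul
      (ContinuousAt.log (continuousAt_const.div continuousAt_id hb0.ne')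
        (div_ne_zero ha0 hb0.ne'))

/-! ### Logarithmic exploration of the neighbours -/

theorem UniformlyGood.eventually_le_mul_realKL {p θ : Fin K → ℝ} {kstar k : Fin K}
    {π : Policy K} (hπ : UniformlyGood p π) (h : UnimodalAt p θ kstar)
    (hk : (k : ℕ) + 1 = (kstar : ℕ) ∨ (k : ℕ) = (kstar : ℕ) + 1) {b : ℝ}
    (hb : b ∈ Set.Ioo (0 : ℝ) 1) (hgt : p kstar * θ kstar < p k * b) {a : ℝ}
    (ha : 0 < a) (ha1 : a < 1) :
    ∀ᶠ T : ℕ in atTop,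
      (1 - a) * Real.log T * (1 - expectedPulls π θ T k / T) - Real.log 2 ≤
        expectedPulls π θ T k * realKL (θ k) b := by
  filter_upwards [hπ.eventually_sub_expectedPulls_le
    (h.update hk (Set.Ioo_subset_Icc_self hb) hgt) ha, eventually_gt_atTop 0] with T hT hT0
  have hT0' : (0 : ℝ) < T := by exact_mod_cast hT0
  have hT1 : (1 : ℝ) ≤ T := by exact_mod_cast hT0
  refine le_expectedPulls_mul_realKL π h.mem_Icc k hb hT0 ?_
  -- The choice `c = (1 - a) * log T` is calibrated so that `T ^ a * exp c = T`.
  have he : Real.exp ((1 - a) * Real.log T) = (T : ℝ) ^ (1 - a) := by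
    rw [Real.rpow_def_of_pos hT0', mul_comm]
  rw [he]
  have h1 : (1 : ℝ) ≤ (T : ℝ) ^ (1 - a) := Real.one_le_rpow hT1 (by linarith)
  calc (T - expectedPulls π (Function.update θ k b) T k) * ((T : ℝ) ^ (1 - a) - 1)
      ≤ (T : ℝ) ^ a * ((T : ℝ) ^ (1 - a) - 1) :=
        mul_le_mul_of_nonneg_right hT (by linarith)
    _ ≤ (T : ℝ) ^ a * (T : ℝ) ^ (1 - a) :=
        mul_le_mul_of_nonneg_left (by linarith) (Real.rpow_nonneg hT0'.le _)
    _ = T := by rw [← Real.rpow_add hT0']; simp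

theorem tendsto_log_natCast : Tendsto (fun T : ℕ => Real.log T) atTop atTop :=
  Real.tendsto_log_atTop.comp tendsto_natCast_atTop_atTop

/-- The exploration cost of a neighbour of the optimal arm, per unit of `log T`. -/
theorem UniformlyGood.eventually_le_cost {p θ : Fin K → ℝ} {kstar k : Fin K}
    {π : Policy K} (hπ : UniformlyGood p π) (h : UnimodalAt p θ kstar)
    (hk : (k : ℕ) + 1 = (kstar : ℕ) ∨ (k : ℕ) = (kstar : ℕ) + 1) (hpk : 0 < p k)
    (hlt : p kstar * θ kstar < p k) {r : ℝ}
    (hr : r < (p kstar * θ kstar - p k * θ k) / realKL (θ k) (p kstar * θ kstar / p k)) :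
    ∀ᶠ T : ℕ in atTop,
      r ≤ expectedPulls π θ T k * (p kstar * θ kstar - p k * θ k) / Real.log T := by
  have hne : k ≠ kstar := by rintro rfl; omega
  have hlog := tendsto_log_natCast.eventually_gt_atTop 0
  have hG : 0 < p kstar * θ kstar - p k * θ k := sub_pos.mpr (h.lt_peak hne)
  set G := p kstar * θ kstar - p k * θ k with hGdef
  set b := p kstar * θ kstar / p k with hbdef
  have hθb : θ k < b := by rw [hbdef, lt_div_iff₀ hpk]; linarith
  have hb1 : b < 1 := (div_lt_one hpk).mpr hlt
  have hθ0 := (h.mem_Icc k).1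
  have hI := realKL_pos hθ0 hθb hb1
  rcases le_or_gt r 0 with hr0 | hr0
  · filter_upwards [hlog] with T hT
    exact hr0.trans
      (div_nonneg (mul_nonneg (expectedPulls_nonneg π h.mem_Icc T k) hG.le) hT.le)
  rw [lt_div_iff₀ hI] at hr
  -- At `b` arm `k` only ties with the peak; continuity allows a strictly better `l` at small cost,
  -- and the slack left pays for `a` below.
  obtain ⟨l, ⟨hl, hl1⟩, hbl⟩ : ∃ l, (r * realKL (θ k) l < G ∧ l < 1) ∧ b < l := by
    have hcont : ContinuousAt (fun x => r * realKL (θ k) x) b :=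
      continuousAt_const.mul
        (continuousAt_realKL (hθb.trans hb1) (hθ0.trans_lt hθb) hb1)
    have hev := (hcont.eventually_lt_const hr).and (Iio_mem_nhds hb1)
    exact ((hev.filter_mono (nhdsWithin_le_nhds (s := Set.Ioi b))).and self_mem_nhdsWithin).exists
  have hIl := realKL_pos hθ0 (hθb.trans hbl) hl1
  obtain ⟨a, ⟨ha, ha1⟩, ha0⟩ : ∃ a : ℝ, (r * realKL (θ k) l < G * (1 - a) ∧ a < 1) ∧ 0 < a := by
    have hcont : ContinuousAt (fun a : ℝ => G * (1 - a)) 0 := by fun_prop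
    have hev := (hcont.eventually_const_lt (u := r * realKL (θ k) l) (by simpa using hl)).and
      (Iio_mem_nhds one_pos)
    exact ((hev.filter_mono (nhdsWithin_le_nhds (s := Set.Ioi 0))).and self_mem_nhdsWithin).exists
  have hlim : Tendsto (fun T : ℕ => G * ((1 - a) * (1 - expectedPulls π θ T k / T)
      - Real.log 2 / Real.log T)) atTop (𝓝 (G * ((1 - a) * (1 - 0) - 0))) :=
    tendsto_const_nhds.mul ((tendsto_const_nhds.mul
      (tendsto_const_nhds.sub (hπ.tendsto_expectedPulls_div h hne))).sub
        (tendsto_const_nhds.div_atTop tendsto_log_natCast))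
  rw [sub_zero, sub_zero, mul_one] at hlim
  have hgt : p kstar * θ kstar < p k * l := by
    rw [hbdef, div_lt_iff₀ hpk] at hbl; linarith
  filter_upwards [hlog, hlim.eventually_const_lt ha, hπ.eventually_le_mul_realKL h hk
    ⟨(hθ0.trans_lt hθb).trans hbl, hl1⟩ hgt ha0 ha1] with T hT h1 h2
  refine le_of_mul_le_mul_right ?_ hIl
  refine h1.le.trans ?_
  rw [div_mul_eq_mul_div, le_div_iff₀ hT]
  have h3 : G * ((1 - a) * (1 - expectedPulls π θ T k / T) - Real.log 2 / Real.log T)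
      * Real.log T = G * ((1 - a) * Real.log T * (1 - expectedPulls π θ T k / T)
        - Real.log 2) := by
    field_simp
  rw [h3]
  linarith [mul_le_mul_of_nonneg_left h2 hG.le]

theorem UniformlyGood.exists_cost {p θ : Fin K → ℝ} (hp : ∀ k, 0 < p k) {kstar k : Fin K}
    {π : Policy K} (hπ : UniformlyGood p π) (h : UnimodalAt p θ kstar)
    (hk : k ∈ neighbours p θ kstar) :
    ∃ D : ℝ, 0 ≤ D ∧
      ENNReal.ofReal (p kstar * θ kstar - p k * θ k) /
        bernoulliKL (θ k) (p kstar * θ kstar / p k) = ENNReal.ofReal D ∧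
      ∀ r < D, ∀ᶠ T : ℕ in atTop,
        r ≤ expectedPulls π θ T k * (p kstar * θ kstar - p k * θ k) / Real.log T := by
  obtain ⟨hadj, hle⟩ := (Finset.mem_filter.mp hk).2
  have hne : k ≠ kstar := by rintro rfl; omega
  have hpk := hp k
  have hG : 0 < p kstar * θ kstar - p k * θ k := sub_pos.mpr (h.lt_peak hne)
  have hθb : θ k < p kstar * θ kstar / p k := by rw [lt_div_iff₀ hpk]; linarith
  have hθ0 := (h.mem_Icc k).1
  -- When `p k` equals the optimal mean, the critical parameter is `1`, the divergence is infinite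
  -- and the term is `0`.
  rcases hle.eq_or_lt with heq | hlt
  · have hb : p kstar * θ kstar / p k = 1 := by rw [heq, div_self hpk.ne']
    rw [hb] at hθb
    refine ⟨0, le_rfl, ?_, fun r hr => ?_⟩
    · rw [hb, bernoulliKL, if_pos (Or.inr ⟨rfl, hθb.ne⟩), ENNReal.div_top, ENNReal.ofReal_zero]
    · filter_upwards [tendsto_log_natCast.eventually_gt_atTop 0] with T hT
      exact hr.le.trans
        (div_nonneg (mul_nonneg (expectedPulls_nonneg π h.mem_Icc T k) hG.le) hT.le)
  · have hb1 : p kstar * θ kstar / p k < 1 := (div_lt_one hpk).mpr hlt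
    have hI := realKL_pos hθ0 hθb hb1
    refine ⟨_, (div_pos hG hI).le, ?_, fun r hr => hπ.eventually_le_cost h hadj hpk hlt hr⟩
    rw [ENNReal.ofReal_div_of_pos hI, bernoulliKL, if_neg, realKL]
    rintro (⟨h0, -⟩ | ⟨h1, -⟩)
    · linarith
    · linarith

theorem card_neighbours_le_two (p θ : Fin K → ℝ) (k : Fin K) :
    (neighbours p θ k).card ≤ 2 := by
  refine (Finset.card_le_card_of_injOn (t := ({(k : ℕ) - 1, (k : ℕ) + 1} : Finset ℕ))
    (fun j : Fin K => (j : ℕ)) (fun j hj => ?_) Fin.val_injective.injOn).trans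
    Finset.card_le_two
  have := (Finset.mem_filter.mp hj).2.1
  simp only [Finset.coe_insert, Finset.coe_singleton, Set.mem_insert_iff, Set.mem_singleton_iff]
  omega

end BeamBandit

/-! ### Summation over the neighbours -/

theorem theorem1 {K : ℕ} (p : Fin K → ℝ) (hp : ∀ k, 0 < p k)
    (π : BeamBandit.Policy K) (hπ : BeamBandit.UniformlyGood p π)
    (θ : Fin K → ℝ) (kstar : Fin K) (hθ : BeamBandit.UnimodalAt p θ kstar) :
    ((BeamBandit.lowerConst p θ kstar : ENNReal) : EReal) ≤
        Filter.liminf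
          (fun T : ℕ => ((BeamBandit.regret π p θ kstar T / Real.log (T : ℝ) : ℝ) : EReal))
          Filter.atTop ∧
      (BeamBandit.neighbours p θ kstar).card ≤ 2 := by
  refine ⟨?_, BeamBandit.card_neighbours_le_two p θ kstar⟩
  choose! D hD0 hD hev using fun k (hk : k ∈ BeamBandit.neighbours p θ kstar) =>
    hπ.exists_cost hp hθ hk
  set N := BeamBandit.neighbours p θ kstar with hN
  rw [BeamBandit.lowerConst, Finset.sum_congr rfl hD, ← ENNReal.ofReal_sum_of_nonneg hD0,
    EReal.coe_ennreal_ofReal, max_eq_left (Finset.sum_nonneg hD0)]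
  rw [← EReal.ge_of_forall_gt_iff_ge]
  intro z hz
  rw [EReal.coe_lt_coe_iff] at hz
  -- Share the slack among the neighbours; the `+ 1` keeps the denominator positive when there are
  -- none.
  set ε := (∑ k ∈ N, D k - z) / (N.card + 1) with hε
  have hε0 : 0 < ε := div_pos (sub_pos.mpr hz) (by positivity)
  have hεmul : ε * (N.card + 1) = ∑ k ∈ N, D k - z := div_mul_cancel₀ _ (by positivity)
  refine le_liminf_of_le (by isBoundedDefault) ?_
  filter_upwards [(Filter.eventually_all_finset N).mpr fun k hk =>
    hev k hk (D k - ε) (sub_lt_self _ hε0),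
    BeamBandit.tendsto_log_natCast.eventually_gt_atTop 0] with T hT hlog
  rw [EReal.coe_le_coe_iff]
  calc z ≤ ∑ k ∈ N, (D k - ε) := by
        rw [Finset.sum_sub_distrib, Finset.sum_const, nsmul_eq_mul]
        linarith
    _ ≤ ∑ k ∈ N, BeamBandit.expectedPulls π θ T k *
          (p kstar * θ kstar - p k * θ k) / Real.log T := Finset.sum_le_sum hT
    _ ≤ BeamBandit.regret π p θ kstar T / Real.log T := by
        rw [← Finset.sum_div, BeamBandit.regret_eq_sum]
        refine div_le_div_of_nonneg_right ?_ hlog.le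
        exact Finset.sum_le_univ_sum_of_nonneg fun k =>
          mul_nonneg (BeamBandit.expectedPulls_nonneg π hθ.mem_Icc T k)
            (sub_nonneg.mpr (hθ.le_peak k))
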